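/- Let $A$ be a set (finite or infinite), let $A^*$ be the free monoid of words over $A$, and let $u,v\in A^*$. Let $N=\langle A\mid u=v\rangle$ be the one-relator monoid, that is, the quotient of $A^*$ by the congruence generated by the pair $(u,v)$, and write $[w]\in N$ for the class of a word $w\in A^*$. The presentation $\langle A\mid u=v\rangle$ is called \emph{incompressible} if there is no non-empty word $r\in A^*$ such that $u,v\in rA^*\cap A^*r$, i.e. no non-empty word which is both a prefix and a suffix of each of $u$ and $v$. Suppose that $\langle A\mid u=v\rangle$ is incompressible and that $u=u'a$ and $v=v'a$ for some letter $a\in A$ and words $u',v'\in A^*$. Then the map $$\psi\colon \mathbb{Z}N\to\mathbb{Z}N,\qquad \psi(\alpha)=\alpha\,([u']-[v']),$$ on the integral monoid ring $\mathbb{Z}N$ is injective. -/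

import Mathlib

/-- The one-relator monoid `⟨A ∣ u = v⟩`: the quotient of the free monoid `A*` by the congruence
generated by the single pair `(u, v)`. The class `[w]` of a word `w` is
`PresentedMonoid.mk _ w`. -/
abbrev OneRelatorMonoid {A : Type*} (u v : FreeMonoid A) : Type _ :=
  PresentedMonoid (fun x y : FreeMonoid A => x = u ∧ y = v)

namespace OneRelatorMonoid

/-- The canonical projection `w ↦ [w]` from the free monoid `A*` onto `⟨A ∣ u = v⟩`. -/
abbrev cls {A : Type*} (u v : FreeMonoid A) : FreeMonoid A →* OneRelatorMonoid u v :=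
  PresentedMonoid.mk _

/-- `r` seals `w` if `w ∈ rA* ∩ A*r`, i.e. `r` is both a prefix and a suffix of `w`
(the two occurrences may overlap). -/
def Seals {A : Type*} (r w : FreeMonoid A) : Prop :=
  (∃ x : FreeMonoid A, w = r * x) ∧ (∃ y : FreeMonoid A, w = y * r)

/-- The presentation `⟨A ∣ u = v⟩` is compressible if some non-empty word seals
both `u` and `v`. -/
def Compressible {A : Type*} (u v : FreeMonoid A) : Prop :=
  ∃ r : FreeMonoid A, r ≠ 1 ∧ Seals r u ∧ Seals r v

/-- The presentation `⟨A ∣ u = v⟩` is incompressible if it is not compressible. -/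
def Incompressible {A : Type*} (u v : FreeMonoid A) : Prop :=
  ¬ Compressible u v

end OneRelatorMonoid

/-! Weigh each rewriting step by an element of an abelian group that depends only on the classes of
its two contexts. Incompressibility makes every closed derivation weigh 0 (`weight_eq_zero`):
working from the side where the common affix of `u` and `v` is shorter, a step at the first letter
must later be undone and the pair can be excised, so first letters cancel (`Path.cancel`) until the
word is empty. Now weigh a step at the right end of a word by the class of its left context, and any
other step by 0. Let η(n) be the weight of a derivation from the representative of n[a] to that of n
followed by a. Then η(n[v']) - η(n[u']) = n (`exists_potential`), so -η extends linearly to a left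
inverse of ψ. -/

namespace OneRelatorMonoid

/-! ### Weighted derivations -/

/-- A single relation application, replacing `l` by `r` in the context `x _ y`, together with its
signed weight `e`. -/
def Edge {A G : Type*} [AddCommGroup G] (u v : List A) (f : List A → List A → G)
    (x y l r : List A) (e : G) : Prop :=
  (l = u ∧ r = v ∧ e = f x y) ∨ (l = v ∧ r = u ∧ e = -f x y)

/-- `Path u v f k w w' g`: there is a derivation of length `k` from `w` to `w'` by the relation
`u = v`, the signed weights `f x y` of whose steps sum to `g`. -/
inductive Path {A G : Type*} [AddCommGroup G] (u v : List A) (f : List A → List A → G) :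
    ℕ → List A → List A → G → Prop
  | nil (w : List A) : Path u v f 0 w w 0
  | cons {k : ℕ} {x y l r w' : List A} {e g : G} (h : Edge u v f x y l r e)
      (q : Path u v f k (x ++ r ++ y) w' g) : Path u v f (k + 1) (x ++ l ++ y) w' (e + g)

/-- The weight `f` depends only on the classes of its two arguments modulo `u = v`. -/
structure IsInvariant {A G : Type*} (u v : List A) (f : List A → List A → G) : Prop where
  left : ∀ x y z, f (x ++ u ++ y) z = f (x ++ v ++ y) z
  right : ∀ x y z, f z (x ++ u ++ y) = f z (x ++ v ++ y)

/-- `p` is the longest common prefix of `u` and `v`, neither of which is a prefix of the other,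
and no non-empty prefix of `p` is a suffix of `u` or of `v`. -/
structure Branches {A : Type*} (p u v : List A) : Prop where
  prefix_left : p <+: u
  prefix_right : p <+: v
  lt_left : p.length < u.length
  lt_right : p.length < v.length
  ne : u[p.length]? ≠ v[p.length]?
  no_overlap_left : ∀ t, t <+: p → t <:+ u → t = []
  no_overlap_right : ∀ t, t <+: p → t <:+ v → t = []

variable {A G : Type*} {u v : List A} {f : List A → List A → G}

theorem IsInvariant.reverse (hf : IsInvariant u v f) :
    IsInvariant u.reverse v.reverse (fun x y => f y.reverse x.reverse) :=
  ⟨fun x y z => by simpa using hf.right y.reverse x.reverse z.reverse,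
    fun x y z => by simpa using hf.left y.reverse x.reverse z.reverse⟩

theorem IsInvariant.append_left (hf : IsInvariant u v f) (z : List A) :
    IsInvariant u v (fun x y => f (z ++ x) y) :=
  ⟨fun x y t => by simpa using hf.left (z ++ x) y t, fun x y t => hf.right x y (z ++ t)⟩

variable [AddCommGroup G]

theorem Edge.symm {x y l r : List A} {e : G} (h : Edge u v f x y l r e) :
    Edge u v f x y r l (-e) := by
  rcases h with ⟨rfl, rfl, rfl⟩ | ⟨rfl, rfl, rfl⟩
  · exact Or.inr ⟨rfl, rfl, rfl⟩
  · exact Or.inl ⟨rfl, rfl, by simp⟩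

theorem Path.trans {k k' : ℕ} {w w' w'' : List A} {g g' : G} (q : Path u v f k w w' g)
    (q' : Path u v f k' w' w'' g') : Path u v f (k + k') w w'' (g + g') := by
  induction q with
  | nil => simpa using q'
  | @cons _ _ _ _ _ _ e _ h _ ih =>
    rw [Nat.add_right_comm, add_assoc e]
    exact .cons h (ih q')

theorem Path.symm {k : ℕ} {w w' : List A} {g : G} (q : Path u v f k w w' g) :
    Path u v f k w' w (-g) := by
  induction q with
  | nil => simpa using Path.nil _
  | cons h _ ih =>
    rw [neg_add_rev]
    refine ih.trans ?_
    simpa using Path.cons h.symm (.nil _)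

theorem Path.append_left {k : ℕ} {w w' : List A} {g : G} (z : List A)
    (q : Path u v (fun x y => f (z ++ x) y) k w w' g) :
    Path u v f k (z ++ w) (z ++ w') g := by
  induction q with
  | nil => exact .nil _
  | @cons k x y l r w' e g h _ ih =>
    have := Path.cons (u := u) (v := v) (f := f) (x := z ++ x) (y := y) (l := l) (r := r) h
      (by simpa using ih)
    simpa using this

theorem Path.append_right {k : ℕ} {w w' : List A} {g : G} (z : List A)
    (q : Path u v (fun x y => f x (y ++ z)) k w w' g) :
    Path u v f k (w ++ z) (w' ++ z) g := by
  induction q with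
  | nil => exact .nil _
  | @cons k x y l r w' e g h _ ih =>
    have := Path.cons (u := u) (v := v) (f := f) (x := x) (y := y ++ z) (l := l) (r := r) h
      (by simpa using ih)
    simpa using this

theorem Path.reverse {k : ℕ} {w w' : List A} {g : G} (q : Path u v f k w w' g) :
    Path u.reverse v.reverse (fun x y => f y.reverse x.reverse) k w.reverse w'.reverse g := by
  induction q with
  | nil => exact .nil _
  | @cons k x y l r w' e g h _ ih =>
    have h' : Edge u.reverse v.reverse (fun x y => f y.reverse x.reverse)
        y.reverse x.reverse l.reverse r.reverse e := by
      simpa [Edge] using h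
    have := Path.cons h' (by simpa using ih)
    simpa using this

theorem IsInvariant.path_right (hf : IsInvariant u v f) {f' : List A → List A → G} {k : ℕ}
    {w w' : List A} {g : G} (q : Path u v f' k w w' g) (z : List A) : f z w = f z w' := by
  induction q with
  | nil => rfl
  | cons h _ ih =>
    rw [← ih]
    rcases h with ⟨rfl, rfl, -⟩ | ⟨rfl, rfl, -⟩
    · exact hf.right ..
    · exact (hf.right ..).symm

/-! ### Cancelling the first letter -/

variable {p : List A}

theorem Branches.prefix_edge (hp : Branches p u v) {x y l r : List A} {e : G}
    (h : Edge u v f x y l r e) : p <+: l ∧ p <+: r := by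
  rcases h with ⟨rfl, rfl, -⟩ | ⟨rfl, rfl, -⟩
  exacts [⟨hp.prefix_left, hp.prefix_right⟩, ⟨hp.prefix_right, hp.prefix_left⟩]

theorem Branches.lt_edge (hp : Branches p u v) {x y l r : List A} {e : G}
    (h : Edge u v f x y l r e) : p.length < l.length ∧ p.length < r.length := by
  rcases h with ⟨rfl, rfl, -⟩ | ⟨rfl, rfl, -⟩
  exacts [⟨hp.lt_left, hp.lt_right⟩, ⟨hp.lt_right, hp.lt_left⟩]

theorem Branches.no_overlap_edge (hp : Branches p u v) {x y l r : List A} {e : G}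
    (h : Edge u v f x y l r e) : ∀ t, t <+: p → t <:+ r → t = [] := by
  rcases h with ⟨rfl, rfl, -⟩ | ⟨rfl, rfl, -⟩
  exacts [hp.no_overlap_right, hp.no_overlap_left]

/-- A derivation splits at its first step in empty left context; the part before that step
descends along the first letter and does not alter the letter at index `p.length`. -/
theorem Path.split (hp : Branches p u v) {k : ℕ} {d : A} {y w w' : List A} {g : G}
    (q : Path u v f k w w' g) (hw : w = d :: y) :
    (∃ y', w' = d :: y' ∧ Path u v (fun x z => f (d :: x) z) k y y' g ∧
      w[p.length]? = w'[p.length]?) ∨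
    ∃ k₁ k₂ y₁ h l r g₁ e g₂, Path u v (fun x z => f (d :: x) z) k₁ y y₁ g₁ ∧
      d :: y₁ = l ++ h ∧ Edge u v f [] h l r e ∧ w[p.length]? = l[p.length]? ∧
      Path u v f k₂ (r ++ h) w' g₂ ∧ k = k₁ + 1 + k₂ ∧ g = g₁ + e + g₂ := by
  induction q generalizing y with
  | nil w => exact .inl ⟨y, hw, .nil _, rfl⟩
  | @cons k x z l r w' e g he q ih =>
    have hl := (hp.lt_edge he).1
    rcases x with _ | ⟨d', x⟩
    · refine .inr ⟨0, k, y, z, l, r, 0, e, g, .nil _, by simpa using hw.symm, he, ?_,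
        by simpa using q, by omega, by simp⟩
      simp [List.getElem?_append_left hl]
    · obtain ⟨rfl, rfl⟩ : d' = d ∧ x ++ l ++ z = y := by simpa using hw
      have he' : Edge u v (fun x z => f (d' :: x) z) x z l r e := he
      -- The change happens after a copy of `p` preceded by at least one letter, hence beyond index
      -- `p.length`.
      have hn : (d' :: x ++ l ++ z)[p.length]? = (d' :: x ++ r ++ z)[p.length]? := by
        obtain ⟨⟨l', rfl⟩, ⟨r', rfl⟩⟩ := hp.prefix_edge he
        have (m : List A) : d' :: x ++ (p ++ m) ++ z = (d' :: x ++ p) ++ (m ++ z) := by simp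
        rw [this, this, List.getElem?_append_left (l₂ := l' ++ z) (by simp),
          List.getElem?_append_left (l₂ := r' ++ z) (by simp)]
      rcases ih rfl with ⟨y', h1, h2, h3⟩ |
        ⟨k₁, k₂, y₁, h, l₁, r₁, g₁, e₁, g₂, h1, h2, h3, h4, h5, h6, h7⟩
      · exact .inl ⟨y', h1, .cons he' h2, hn.trans h3⟩
      · exact .inr ⟨k₁ + 1, k₂, y₁, h, l₁, r₁, e + g₁, e₁, g₂, .cons he' h1, h2, h3, hn.trans h4, h5,
          by omega, by rw [h7]; abel⟩

/-- A prefix none of whose suffixes starts an occurrence of `p` is inert. -/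
theorem Path.descend_of_no_overlap (hp : Branches p u v) {t : List A} (ht : t.length ≤ p.length)
    (hov : ∀ t', t' <+: p → t' <:+ t → t' = []) {k : ℕ} {w w' y : List A} {g : G}
    (q : Path u v f k w w' g) (hw : w = t ++ y) :
    ∃ y', w' = t ++ y' ∧ Path u v (fun x z => f (t ++ x) z) k y y' g := by
  induction q generalizing y with
  | nil w => exact ⟨y, hw, .nil _⟩
  | @cons k x z l r w' e g he q ih =>
    obtain ⟨x', rfl⟩ : t <+: x := by
      rw [List.append_assoc] at hw
      rcases List.append_eq_append_iff.1 hw with ⟨t', rfl, h2⟩ | ⟨x', h1, -⟩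
      · have : t' = [] := by
          refine hov t' ?_ (List.suffix_append _ _)
          refine List.prefix_of_prefix_length_le (l₃ := l ++ z) ⟨y, h2.symm⟩
            ((hp.prefix_edge he).1.trans (List.prefix_append _ _)) ?_
          simp at ht; omega
        simp [this]
      · exact ⟨x', h1.symm⟩
    obtain rfl : x' ++ l ++ z = y := by simpa using hw
    obtain ⟨y', h1, h2⟩ := ih (y := x' ++ r ++ z) (by simp)
    have he' : Edge u v (fun x z => f (t ++ x) z) x' z l r e := he
    exact ⟨y', h1, .cons he' h2⟩

/-- `hC` will be the induction hypothesis of `Path.cancel`. Keeping the `n` letters of `t` ensures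
that index `n` always falls in the common prefix. -/
theorem Path.strip_of_cancel {n J : ℕ}
    (hC : ∀ j ≤ J, ∀ (f : List A → List A → G), IsInvariant u v f → ∀ d y y' g,
      Path u v f j (d :: y) (d :: y') g → (d :: y)[n]? = (d :: y')[n]? →
      ∃ j' ≤ j, Path u v (fun x z => f (d :: x) z) j' y y' g)
    {t : List A} (ht : t.length = n) {y y' : List A} {g : G} (z : List A) {j : ℕ} (hj : j ≤ J)
    (f : List A → List A → G) (hf : IsInvariant u v f)
    (q : Path u v f j (z ++ t ++ y) (z ++ t ++ y') g) :
    ∃ j' ≤ j, Path u v (fun x w => f (z ++ x) w) j' (t ++ y) (t ++ y') g := by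
  induction z generalizing f j with
  | nil => exact ⟨j, le_rfl, by simpa using q⟩
  | cons d z ih =>
    obtain ⟨j₁, h1, q₁⟩ := hC j hj f hf d (z ++ t ++ y) (z ++ t ++ y') g (by simpa using q) (by
      rw [← List.cons_append, ← List.cons_append, ← List.cons_append, ← List.cons_append,
        List.getElem?_append_left (l₂ := y) (by simp; omega),
        List.getElem?_append_left (l₂ := y') (by simp; omega)])
    obtain ⟨j₂, h2, q₂⟩ := ih (h1.trans hj) _ (hf.append_left [d]) q₁
    exact ⟨j₂, h2.trans h1, q₂⟩

/-- Only a step with empty left context can change the letter at index `p.length`. Since this letter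
is the same at both ends, the first such step is followed by an inverse one; replaying what lies
between them behind the other relator removes both. -/
theorem Path.cancel (hp : Branches p u v) (k : ℕ) :
    ∀ (f : List A → List A → G), IsInvariant u v f → ∀ d y y' g,
      Path u v f k (d :: y) (d :: y') g → (d :: y)[p.length]? = (d :: y')[p.length]? →
      ∃ k' ≤ k, Path u v (fun x z => f (d :: x) z) k' y y' g := by
  induction k using Nat.strong_induction_on with
  | _ k IH =>
  intro f hf d y y' g q hn
  rcases q.split hp rfl with ⟨y₁, h1, h2, -⟩ |
    ⟨k₁, k₂, y₁, h, l, r, g₁, e, g₂, q₁, hy₁, he, hl, q₂, rfl, rfl⟩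
  · obtain rfl : y' = y₁ := by simpa using h1
    exact ⟨k, le_rfl, h2⟩
  have hlr : l[p.length]? ≠ r[p.length]? := by
    rcases he with ⟨rfl, rfl, -⟩ | ⟨rfl, rfl, -⟩
    exacts [hp.ne, hp.ne.symm]
  have hrlen := (hp.lt_edge he).2
  have hrh : (r ++ h)[p.length]? = r[p.length]? := List.getElem?_append_left hrlen
  obtain ⟨d', y₂, hd'⟩ : ∃ d' y₂, r ++ h = d' :: y₂ := by
    cases r with
    | nil => simp at hrlen
    | cons d' r => exact ⟨d', r ++ h, rfl⟩
  rcases q₂.split hp hd' with ⟨y₃, h1, -, h3⟩ |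
    ⟨k₃, k₄, y₃, h', l', r', g₃, e', g₄, q₃, hy₃, he', hl', q₄, rfl, rfl⟩
  · exact absurd (hl.symm.trans (hn.trans (h3.symm.trans hrh))) hlr
  have hl'r : l' = r ∧ r' = l ∧ e' = -f [] h' ∧ e = f [] h ∨
      l' = r ∧ r' = l ∧ e' = f [] h' ∧ e = -f [] h := by
    rw [hrh] at hl'
    rcases he with ⟨rfl, rfl, rfl⟩ | ⟨rfl, rfl, rfl⟩ <;>
      rcases he' with ⟨rfl, rfl, rfl⟩ | ⟨rfl, rfl, rfl⟩ <;> simp_all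
  obtain ⟨rfl, rfl⟩ : l' = r ∧ r' = l := by tauto
  have q₅ : Path u v f k₃ (l' ++ h) (l' ++ h') g₃ := by
    rw [hd', ← hy₃]
    exact q₃.append_left [d']
  have hzt : l'.take (l'.length - p.length) ++ l'.drop (l'.length - p.length) = l' :=
    List.take_append_drop _ _
  have ht : (l'.drop (l'.length - p.length)).length = p.length := by simp; omega
  obtain ⟨j, hj, q₆⟩ := Path.strip_of_cancel (J := k₃)
    (fun j hj => IH j (by omega)) ht _ le_rfl f hf (by rw [hzt]; exact q₅)
  -- The letters left over form a suffix of a relator, so no step can start inside them.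
  obtain ⟨y₄, hy₄, q₇⟩ := q₆.descend_of_no_overlap hp ht.le
    (fun t h1 h2 => hp.no_overlap_edge he t h1 (h2.trans (List.drop_suffix _ _))) rfl
  obtain rfl : h' = y₄ := by simpa using hy₄
  have hfun : (fun x z => f (l' ++ x) z) = fun x z => f (r' ++ x) z := by
    funext x z
    have := hf.left [] x z
    rcases he with ⟨rfl, rfl, -⟩ | ⟨rfl, rfl, -⟩ <;> simp_all
  have q₈ : Path u v f j (r' ++ h) (r' ++ h') g₃ := by
    refine Path.append_left _ ?_
    rw [← hfun]
    have h2 : (fun x z => f (l' ++ x) z) = fun x z =>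
        f (l'.take (l'.length - p.length) ++ (l'.drop (l'.length - p.length) ++ x)) z := by
      simp only [← List.append_assoc, hzt]
    rw [h2]
    exact q₇
  -- `q₇` shows that `h` and `h'` are congruent, so the two opposite steps have opposite weights.
  have hee : e + e' = 0 := by
    have := hf.path_right q₇ []
    rcases hl'r with ⟨-, -, rfl, rfl⟩ | ⟨-, -, rfl, rfl⟩ <;> simp [this]
  have q₉ : Path u v f (k₁ + j + k₄) (d :: y) (d :: y') (g₁ + g₃ + g₄) :=
    ((q₁.append_left [d]).trans (by simpa [hy₁] using q₈)).trans q₄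
  obtain ⟨k', hk', q'⟩ := IH _ (by omega) f hf d y y' _ q₉ hn
  refine ⟨k', by omega, ?_⟩
  have : g₁ + e + (g₃ + e' + g₄) = g₁ + g₃ + g₄ := by
    have : g₁ + e + (g₃ + e' + g₄) = g₁ + g₃ + g₄ + (e + e') := by abel
    rw [this, hee, add_zero]
  rwa [this]

theorem Branches.weight_eq_zero (hp : Branches p u v) (hf : IsInvariant u v f) {k : ℕ}
    {w : List A} {g : G} (q : Path u v f k w w g) : g = 0 := by
  induction w generalizing f k with
  | nil =>
    generalize hw : ([] : List A) = w at q
    cases q with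
    | nil => rfl
    | cons he _ =>
      have := (hp.lt_edge he).1
      simp_all
  | cons d w ih =>
    obtain ⟨k', -, q'⟩ := Path.cancel hp k f hf d w w g q rfl
    exact ih (hf.append_left [d]) q'

/-! ### Asphericity of incompressible presentations -/

theorem exists_longest_common_prefix (u v : List A) :
    ∃ p, p <+: u ∧ p <+: v ∧ (p = u ∨ p = v ∨ u[p.length]? ≠ v[p.length]?) := by
  induction u generalizing v with
  | nil => exact ⟨[], by simp⟩
  | cons b u ih =>
    cases v with
    | nil => exact ⟨[], by simp⟩
    | cons c v =>
      by_cases hbc : b = c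
      · obtain ⟨p, h1, h2, h3⟩ := ih v
        subst hbc
        exact ⟨b :: p, by simpa using h1, by simpa using h2, by simpa using h3⟩
      · exact ⟨[], by simp, by simp, by simp [hbc]⟩

/-- A prefix of `p` that is a suffix of `u` or `v` is no longer than `s`, so it is a suffix of `s`
and seals both words. -/
theorem branches_of_length_le (hu : u ≠ []) (hv : v ≠ [])
    (hinc : ∀ t, t <+: u → t <+: v → t <:+ u → t <:+ v → t = []) {s : List A} (hpu : p <+: u)
    (hpv : p <+: v) (hp : p = u ∨ p = v ∨ u[p.length]? ≠ v[p.length]?) (hsu : s <:+ u)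
    (hsv : s <:+ v) (h : p.length ≤ s.length) : Branches p u v := by
  have hnu : p ≠ u := by
    rintro rfl
    obtain rfl := hsu.eq_of_length_le h
    exact hu (hinc s hpu hpv hsu hsv)
  have hnv : p ≠ v := by
    rintro rfl
    obtain rfl := hsv.eq_of_length_le h
    exact hv (hinc s hpu hpv hsu hsv)
  have key {t w : List A} (hsw : s <:+ w) (htp : t <+: p) (htw : t <:+ w) : t = [] := by
    have hts : t <:+ s := List.suffix_of_suffix_length_le htw hsw (htp.length_le.trans h)
    exact hinc t (htp.trans hpu) (htp.trans hpv) (hts.trans hsu) (hts.trans hsv)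
  exact ⟨hpu, hpv, lt_of_not_ge fun h => hnu (hpu.eq_of_length_le h),
    lt_of_not_ge fun h => hnv (hpv.eq_of_length_le h), by tauto,
    fun t => key hsu, fun t => key hsv⟩

/-- The presentation `⟨A ∣ u = v⟩` is aspherical if `u` and `v` are non-empty and no non-empty word
seals both: every closed derivation has trivial weight. -/
theorem weight_eq_zero (hu : u ≠ []) (hv : v ≠ [])
    (hinc : ∀ t, t <+: u → t <+: v → t <:+ u → t <:+ v → t = []) (hf : IsInvariant u v f) {k : ℕ}
    {w : List A} {g : G} (q : Path u v f k w w g) : g = 0 := by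
  obtain ⟨p, hpu, hpv, hp⟩ := exists_longest_common_prefix u v
  obtain ⟨s, hsu, hsv, hs⟩ := exists_longest_common_prefix u.reverse v.reverse
  have hsu' : s.reverse <:+ u := by simpa using List.reverse_suffix.2 hsu
  have hsv' : s.reverse <:+ v := by simpa using List.reverse_suffix.2 hsv
  rcases le_total p.length s.length with h | h
  · exact (branches_of_length_le hu hv hinc hpu hpv hp hsu' hsv' (by simpa using h)).weight_eq_zero
      hf q
  · refine (branches_of_length_le (u := u.reverse) (v := v.reverse) (p := s) (s := p.reverse)
      (by simpa using hu) (by simpa using hv) ?_ hsu hsv hs (List.reverse_suffix.2 hpu)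
      (List.reverse_suffix.2 hpv) (by simpa using h)).weight_eq_zero hf.reverse q.reverse
    intro t h1 h2 h3 h4
    have h1' : t.reverse <:+ u := by simpa using List.reverse_suffix.2 h1
    have h2' : t.reverse <:+ v := by simpa using List.reverse_suffix.2 h2
    have h3' : t.reverse <+: u := by simpa using List.reverse_prefix.2 h3
    have h4' : t.reverse <+: v := by simpa using List.reverse_prefix.2 h4
    simpa using hinc _ h3' h4' h1' h2'

/-! ### The potential on the monoid -/

/-- Words with the same class are joined by a derivation. -/
theorem exists_path_of_cls_eq (f : List A → List A → G) {x y : FreeMonoid A}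
    (h : cls (FreeMonoid.ofList u) (FreeMonoid.ofList v) x =
      cls (FreeMonoid.ofList u) (FreeMonoid.ofList v) y) :
    ∃ k g, Path u v f k x.toList y.toList g := by
  rw [PresentedMonoid.mk_eq_mk_iff] at h
  replace h : ConGen.Rel _ x y := h
  induction h generalizing f with
  | of x y h =>
    have he : Edge u v f [] [] u v (f [] []) := Or.inl ⟨rfl, rfl, rfl⟩
    rw [h.1, h.2]
    exact ⟨1, f [] [] + 0, by simpa using Path.cons he (.nil _)⟩
  | refl x => exact ⟨0, 0, .nil _⟩
  | symm _ ih =>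
    obtain ⟨k, g, q⟩ := ih f
    exact ⟨k, _, q.symm⟩
  | trans _ _ ih₁ ih₂ =>
    obtain ⟨k₁, g₁, q₁⟩ := ih₁ f
    obtain ⟨k₂, g₂, q₂⟩ := ih₂ f
    exact ⟨_, _, q₁.trans q₂⟩
  | @mul w x y z _ _ ih₁ ih₂ =>
    obtain ⟨k₁, g₁, q₁⟩ := ih₁ (fun a b => f a (b ++ y.toList))
    obtain ⟨k₂, g₂, q₂⟩ := ih₂ (fun a b => f (x.toList ++ a) b)
    exact ⟨_, _, (q₁.append_right _).trans (q₂.append_left _)⟩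

theorem Path.weight_eq_zero_of_forall {k : ℕ} {w w' : List A} {g : G} (q : Path u v f k w w' g)
    (h : ∀ x y, f x y = 0) : g = 0 := by
  induction q with
  | nil => rfl
  | cons he _ ih => rcases he with ⟨-, -, rfl⟩ | ⟨-, -, rfl⟩ <;> simp [h, ih]

open Classical in
/-- The weight recording the class of the left context of the steps with empty right context. -/
noncomputable def leftWeight (u v : List A) (x y : List A) :
    MonoidAlgebra ℤ (OneRelatorMonoid (FreeMonoid.ofList u) (FreeMonoid.ofList v)) :=
  if y = [] then MonoidAlgebra.of ℤ _ (cls _ _ (FreeMonoid.ofList x)) else 0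

theorem cls_relator (u v : FreeMonoid A) : cls u v u = cls u v v :=
  PresentedMonoid.mk_eq_mk_of_rel ⟨rfl, rfl⟩

theorem isInvariant_leftWeight (hu : u ≠ []) (hv : v ≠ []) :
    IsInvariant u v (leftWeight u v) := by
  refine ⟨fun x y z => ?_, fun x y z => ?_⟩
  · have h : cls (FreeMonoid.ofList u) (FreeMonoid.ofList v) (FreeMonoid.ofList (x ++ u ++ y)) =
        cls (FreeMonoid.ofList u) (FreeMonoid.ofList v) (FreeMonoid.ofList (x ++ v ++ y)) := by
      simp only [FreeMonoid.ofList_append, map_mul]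
      rw [cls_relator]
    simp only [leftWeight, h]
  -- A right context containing a relator is non-empty, so both weights are 0.
  · simp [leftWeight, hu, hv]

/-- A function on `⟨A ∣ u = v⟩` inverting the differences `n[u'] - n[v']`. -/
theorem exists_potential {u' v' : List A} {a : A} (hu : u = u' ++ [a]) (hv : v = v' ++ [a])
    (hinc : ∀ t, t <+: u → t <+: v → t <:+ u → t <:+ v → t = []) :
    ∃ η : OneRelatorMonoid (FreeMonoid.ofList u) (FreeMonoid.ofList v) →
        MonoidAlgebra ℤ (OneRelatorMonoid (FreeMonoid.ofList u) (FreeMonoid.ofList v)),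
      ∀ n, η (n * cls _ _ (FreeMonoid.ofList v')) - η (n * cls _ _ (FreeMonoid.ofList u')) =
        MonoidAlgebra.of ℤ _ n := by
  have hu0 : u ≠ [] := by simp [hu]
  have hv0 : v ≠ [] := by simp [hv]
  set π := cls (FreeMonoid.ofList u) (FreeMonoid.ofList v) with hπ
  choose ρ hρ using PresentedMonoid.surjective_mk
    (rels := fun x y : FreeMonoid A => x = FreeMonoid.ofList u ∧ y = FreeMonoid.ofList v)
  have hρ' : ∀ n, π (ρ n) = n := hρ
  have hex (n) : ∃ k g, Path u v (leftWeight u v) k (ρ (n * π (.of a))).toList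
      ((ρ n).toList ++ [a]) g :=
    exists_path_of_cls_eq (x := ρ (n * π (.of a))) (y := ρ n * .of a) _ <| by
      rw [← hπ, map_mul, hρ', hρ']
  choose κ η hη using hex
  have hη' (w : FreeMonoid A) : ∃ k, Path u v (leftWeight u v) k
      (ρ (π (w * .of a))).toList (w.toList ++ [a]) (η (π w)) := by
    -- With `a` appended, every right context is non-empty, so changing the representative costs no
    -- weight.
    obtain ⟨k, g, q⟩ := exists_path_of_cls_eq (u := u) (v := v)
      (fun x y => leftWeight u v x (y ++ [a])) (x := ρ (π w)) (y := w) (hρ' _)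
    obtain rfl := q.weight_eq_zero_of_forall (by simp [leftWeight])
    have := (hη (π w)).trans (q.append_right [a])
    rw [map_mul]
    exact ⟨_, by simpa using this⟩
  refine ⟨η, fun n => ?_⟩
  set x := ρ n with hx
  have hn : n = π x := (hρ' n).symm
  obtain ⟨k₁, q₁⟩ := hη' (x * .ofList u')
  obtain ⟨k₂, q₂⟩ := hη' (x * .ofList v')
  have hua : x * .ofList u' * .of a = x * .ofList u := by rw [hu, mul_assoc]; rfl
  have hva : x * .ofList v' * .of a = x * .ofList v := by rw [hv, mul_assoc]; rfl
  have hxu : (x * .ofList u').toList ++ [a] = x.toList ++ u ++ [] := by simp [hu]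
  have hxv : (x * .ofList v').toList ++ [a] = x.toList ++ v ++ [] := by simp [hv]
  rw [hua, hxu] at q₁
  rw [hva, hxv] at q₂
  have hrel : π (x * .ofList u) = π (x * .ofList v) := by
    rw [map_mul, map_mul, hπ, cls_relator]
  rw [hrel] at q₁
  have he : Edge u v (leftWeight u v) x.toList [] u v (MonoidAlgebra.of ℤ _ (π x)) :=
    Or.inl ⟨rfl, rfl, by simp [leftWeight, hπ]⟩
  -- The loop through x u and x v, based at the representative of n[u] = n[v], weighs η(n[u']) + n -
  -- η(n[v']).
  have h0 := weight_eq_zero hu0 hv0 hinc (isInvariant_leftWeight hu0 hv0)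
    (q₁.trans (.cons he q₂.symm))
  rw [map_mul, map_mul, ← hn] at h0
  rw [sub_eq_iff_eq_add, ← sub_eq_zero, ← neg_eq_zero, ← h0]
  abel

end OneRelatorMonoid

theorem mainTheorem7 {A : Type*} (u v u' v' : FreeMonoid A) (a : A)
    (hu : u = u' * FreeMonoid.of a) (hv : v = v' * FreeMonoid.of a)
    (hinc : OneRelatorMonoid.Incompressible u v) :
    Function.Injective
      (fun α : MonoidAlgebra ℤ (OneRelatorMonoid u v) =>
        α * (MonoidAlgebra.of ℤ (OneRelatorMonoid u v) (OneRelatorMonoid.cls u v u') -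
          MonoidAlgebra.of ℤ (OneRelatorMonoid u v) (OneRelatorMonoid.cls u v v'))) := by
  have hinc' : ∀ t : List A, t <+: u.toList → t <+: v.toList → t <:+ u.toList → t <:+ v.toList →
      t = [] := by
    rintro t ⟨x, hx⟩ ⟨y, hy⟩ ⟨x', hx'⟩ ⟨y', hy'⟩
    by_contra ht
    exact hinc ⟨.ofList t, ht, ⟨⟨.ofList x, hx.symm⟩, ⟨.ofList x', hx'.symm⟩⟩,
      ⟨⟨.ofList y, hy.symm⟩, ⟨.ofList y', hy'.symm⟩⟩⟩
  obtain ⟨η, hη⟩ : ∃ η : OneRelatorMonoid u v → MonoidAlgebra ℤ (OneRelatorMonoid u v),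
      ∀ n, η (n * OneRelatorMonoid.cls u v v') - η (n * OneRelatorMonoid.cls u v u') =
        MonoidAlgebra.of ℤ (OneRelatorMonoid u v) n :=
    OneRelatorMonoid.exists_potential (u := u.toList) (v := v.toList) (u' := u'.toList)
      (v' := v'.toList) (a := a) (by simp [hu]) (by simp [hv]) hinc'
  let E : MonoidAlgebra ℤ (OneRelatorMonoid u v) →+ MonoidAlgebra ℤ (OneRelatorMonoid u v) :=
    MonoidAlgebra.liftNC (Int.castAddHom _) η
  have hE (n : OneRelatorMonoid u v) (c : ℤ) : E (MonoidAlgebra.single n c) = c • η n := by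
    simp [E]
  refine Function.LeftInverse.injective (g := fun α => -E α) fun α => ?_
  induction α using MonoidAlgebra.induction_linear with
  | zero => simp
  | add α β hα hβ =>
    simp only [add_mul, map_add, neg_add] at hα hβ ⊢
    rw [hα, hβ]
  | single n c =>
    have h : MonoidAlgebra.single n c = c • (η (n * OneRelatorMonoid.cls u v v') -
        η (n * OneRelatorMonoid.cls u v u')) := by
      rw [hη n]
      simp
    simp only [MonoidAlgebra.of_apply, mul_sub, MonoidAlgebra.single_mul_single, mul_one, map_sub,
      hE]
    rw [h, smul_sub]
    abel
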